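/- Let $B>1$ and $m\ge 2$. Let $\mathfrak B_0,\mathfrak B_1,\mathfrak B_2,\dots$ be random boxes $\mathfrak B_n=\prod_{i=1}^m[a_i^{(n)},b_i^{(n)}]$, $a_i^{(n)}<b_i^{(n)}$, on a probability space, with side lengths $S_i^{(n)}=b_i^{(n)}-a_i^{(n)}$, and let $P_i^{(n)}=S_i^{(n)}/S_i^{(n-1)}$ ($n\ge1$) be the proportion cuts. Assume that this is a linear fragmentation process: the $P_i^{(n)}$ ($n\ge 1$, $1\le i\le m$) are independent of each other and of $\mathfrak B_0$ (which may be fixed or random); for each $i$ the law of $P_i^{(n)}$ is the same for all $n$, namely that of a random variable $P_i$, which has no atoms and a finite third moment; and there are $\mu_P\in\mathbb R$ and $\sigma_P>0$ with $\mathbb E[\log_B P_i]=\mu_P$ and $\mathrm{Var}[\log_B P_i]=\sigma_P^2$ for all $i$. (The boxes may be nested, $\mathfrak B_0\supset\mathfrak B_1\supset\cdots$, but this is not required; in particular the normalization $\mu_P=0$, $\sigma_P=1$, for which some cuts exceed $1$, is allowed.) Suppose moreover that $\log P_i\in[-C,C]$ almost surely for all $i$ and some constant $C>0$, and that for some $\delta>0$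 the normalized sums $$Z_i^{(N)}=\frac{\log_B\bigl(P_i^{(1)}\cdots P_i^{(N)}\bigr)-N\mu_P}{\sqrt N\,\sigma_P}$$ have, for all large $N$, a probability density $\varphi(z)+O(N^{-1/2-\delta})$ and a distribution function $\Phi(z)+O(N^{-\delta})$, uniformly in $z\in\mathbb R$, where $\varphi$ and $\Phi$ are the density and distribution function of the standard normal law. Let $1\le d\le m$, let $\mathfrak m_d^{(N)}=\max_{|I|=d}\prod_{i\in I}S_i^{(N)}$ be the product of the $d$ longest sides of $\mathfrak B_N$, and let $V_d^{(N)}=2^{m-d}\sum_{|I|=d}\prod_{i\in I}S_i^{(N)}$ be the total volume of its $d$-dimensional faces. Then $\mathfrak m_d^{(N)}$ and $V_d^{(N)}$ both converge to strong Benford behavior base $B$ as $N\to\infty$. Here $X^{(N)}$ converges to strong Benford behavior base $B$ if $\mathbb P(S_B(X^{(N)})\le s)\to\log_B s$ for every $s\in[1,B]$, where the significand $S_B(x)$ of $x>0$ is the unique number in $[1,B)$ with $x=S_B(x)B^k$ for some $k\in\mathbb Z$. -/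

import Mathlib

open Filter Topology MeasureTheory ProbabilityTheory

namespace BoxFragmentation

noncomputable section

/-- The significand base `B` of a real number; for `B > 1` and `x > 0` it is characterised by
`significand_spec` and `significand_unique` below. -/
def significand (B x : ℝ) : ℝ := x / B ^ ⌊Real.logb B x⌋

theorem significand_spec {B x : ℝ} (hB : 1 < B) (hx : 0 < x) :
    significand B x ∈ Set.Ico 1 B ∧ ∃ k : ℤ, x = significand B x * B ^ k := by
  have hB0 : 0 < B := by linarith
  have hk : (0 : ℝ) < B ^ ⌊Real.logb B x⌋ := zpow_pos hB0 _
  have hx' : B ^ Real.logb B x = x := Real.rpow_logb hB0 hB.ne' hx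
  refine ⟨⟨?_, ?_⟩, ⌊Real.logb B x⌋, by unfold significand; field_simp⟩
  · rw [significand, le_div_iff₀ hk, one_mul, ← Real.rpow_intCast]
    calc B ^ ((⌊Real.logb B x⌋ : ℤ) : ℝ) ≤ B ^ Real.logb B x :=
          Real.rpow_le_rpow_of_exponent_le hB.le (Int.floor_le _)
      _ = x := hx'
  · rw [significand, div_lt_iff₀ hk, ← Real.rpow_intCast]
    calc x = B ^ Real.logb B x := hx'.symm
      _ < B ^ (((⌊Real.logb B x⌋ : ℤ) : ℝ) + 1) :=
          Real.rpow_lt_rpow_of_exponent_lt hB (Int.lt_floor_add_one _)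
      _ = B * B ^ ((⌊Real.logb B x⌋ : ℤ) : ℝ) := by
          rw [Real.rpow_add hB0, Real.rpow_one, mul_comm]

theorem significand_unique {B x s : ℝ} (hB : 1 < B) (hs : s ∈ Set.Ico 1 B) {k : ℤ}
    (h : x = s * B ^ k) : significand B x = s := by
  have hB0 : 0 < B := by linarith
  have hs0 : 0 < s := by linarith [hs.1]
  have hlog : Real.logb B x = Real.logb B s + k := by
    rw [h, Real.logb_mul hs0.ne' (zpow_pos hB0 k).ne', ← Real.rpow_intCast,
      Real.logb_rpow hB0 hB.ne']
  have h0 : 0 ≤ Real.logb B s := Real.logb_nonneg hB hs.1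
  have h1 : Real.logb B s < 1 := by
    rw [Real.logb_lt_iff_lt_rpow hB hs0, Real.rpow_one]; exact hs.2
  have hfl : ⌊Real.logb B x⌋ = k := by
    rw [hlog, Int.floor_add_intCast, Int.floor_eq_zero_iff.2 ⟨h0, h1⟩, zero_add]
  rw [significand, hfl, h, mul_div_assoc, div_self (zpow_pos hB0 k).ne', mul_one]

/-- The random variables `X 0, X 1, …` converge to strong Benford behavior base `B`. -/
def ConvergesToStrongBenford {Ω : Type*} [MeasurableSpace Ω] (Pr : Measure Ω) (B : ℝ)
    (X : ℕ → Ω → ℝ) : Prop :=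
  ∀ s ∈ Set.Icc 1 B,
    Tendsto (fun n => Pr.real {ω | significand B (X n ω) ≤ s}) atTop (𝓝 (Real.logb B s))

/-- The length of the `i`-th side of a (nondegenerate, bounded) box. -/
def sideLength {m : ℕ} (b : BoxIntegral.Box (Fin m)) (i : Fin m) : ℝ := b.upper i - b.lower i

/-- The `d`-volume of an `m`-dimensional box (`d ≤ m`): the sum of the `d`-dimensional volumes of
its `d`-dimensional faces. -/
def dVolume {m : ℕ} (d : ℕ) (b : BoxIntegral.Box (Fin m)) : ℝ :=
  2 ^ (m - d) * ∑ I ∈ (Finset.univ : Finset (Fin m)).powersetCard d, ∏ i ∈ I, sideLength b i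

/-- The maximal product of `d` distinct sides of an `m`-dimensional box (`d ≤ m`), i.e. the largest
volume of a `d`-dimensional face. The supremum is over a finite set, nonempty for `d ≤ m`. -/
def maxFaceVolume {m : ℕ} (d : ℕ) (b : BoxIntegral.Box (Fin m)) : ℝ :=
  ⨆ I : {I : Finset (Fin m) // I.card = d}, ∏ i ∈ I.1, sideLength b i

/-- The proportion cut along axis `i` in the step from the `n`-th to the `(n+1)`-st box. -/
def cut {Ω : Type*} {m : ℕ} (𝔅 : ℕ → Ω → BoxIntegral.Box (Fin m)) (n : ℕ) (i : Fin m) (ω : Ω) :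
    ℝ :=
  sideLength (𝔅 (n + 1) ω) i / sideLength (𝔅 n ω) i

/-- A linear fragmentation process of random `m`-dimensional boxes: the proportion cuts along the
axes are independent over all stages and axes, independent of the initial box (which may be fixed or
random), with a law that depends on the axis only. The laws have no atoms and a finite third
moment, and `log_B` of the cuts have common mean `μP` and common variance `σP ^ 2 > 0`.

Nestedness of the boxes is not part of the definition: nested processes (all cuts `≤ 1`) are
included, and so are normalised processes with `μP = 0`, in which some cuts must exceed `1`. -/
structure IsLinearFragmentation {Ω : Type*} [MeasurableSpace Ω] (Pr : Measure Ω) {m : ℕ}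
    (B : ℝ) (𝔅 : ℕ → Ω → BoxIntegral.Box (Fin m)) (μP σP : ℝ) : Prop where
  measurable_lower : ∀ n, Measurable fun ω => (𝔅 n ω).lower
  measurable_upper : ∀ n, Measurable fun ω => (𝔅 n ω).upper
  indep_cuts : iIndepFun (fun (q : ℕ × Fin m) ω => cut 𝔅 q.1 q.2 ω) Pr
  indep_initial : IndepFun (fun ω => ((𝔅 0 ω).lower, (𝔅 0 ω).upper))
    (fun ω (q : ℕ × Fin m) => cut 𝔅 q.1 q.2 ω) Pr
  identDistrib : ∀ n i, IdentDistrib (cut 𝔅 n i) (cut 𝔅 0 i) Pr Pr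
  continuous_law : ∀ i x, Pr {ω | cut 𝔅 0 i ω = x} = 0
  third_moment : ∀ i, MemLp (cut 𝔅 0 i) 3 Pr
  log_memLp : ∀ i, MemLp (fun ω => Real.logb B (cut 𝔅 0 i ω)) 2 Pr
  log_mean : ∀ i, ∫ ω, Real.logb B (cut 𝔅 0 i ω) ∂Pr = μP
  log_variance : ∀ i, variance (fun ω => Real.logb B (cut 𝔅 0 i ω)) Pr = σP ^ 2
  sd_pos : 0 < σP

/-- The normalised logarithm of the product of the first `N` cuts along axis `i`. -/
def Z {Ω : Type*} {m : ℕ} (B : ℝ) (𝔅 : ℕ → Ω → BoxIntegral.Box (Fin m)) (μP σP : ℝ)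
    (i : Fin m) (N : ℕ) (ω : Ω) : ℝ :=
  (Real.logb B (∏ k ∈ Finset.range N, cut 𝔅 k i ω) - N * μP) / (Real.sqrt N * σP)

end

end BoxFragmentation

/-! Up to a common constant, the logarithm of the `i`-th side of the `N`-th box is its initial value
plus √N σ times `Z i N`, the `Z i N` being independent of each other and of the initial box. Both
functionals are positive and homogeneous of degree `d`, so moving every `Z` coordinate by u / (d √N
σ) multiplies them by `B ^ u`, i.e. adds u to their base-`B` logarithm. This displacement tends to
0, while the joint density of the `Z` converges to a Gaussian one. By Scheffé's lemma the
convergence holds in L¹, so the translation changes probabilities by o(1)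
(`tendsto_integral_abs_prod_shift_sub`, `abs_measureReal_shift_sub_le`). The law of the logarithm
modulo one is thus asymptotically invariant under each shift u; but its average over u in [0, 1] is
exactly uniform, so it is itself asymptotically uniform (`tendsto_measureReal_fract_le`). This is
strong Benford behavior. -/

namespace BoxFragmentation

/-! ### Densities: L¹ convergence and small translations -/

/-- **Scheffé's lemma** for probability densities. -/
theorem tendsto_integral_abs_sub_of_tendsto_density {α : Type*} [MeasurableSpace α] {μ : Measure α}
    {g : ℕ → α → ℝ} {g₀ : α → ℝ} (hg : ∀ n, Integrable (g n) μ) (hg₀ : Integrable g₀ μ)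
    (hg_nonneg : ∀ n x, 0 ≤ g n x) (hg_one : ∀ n, ∫ x, g n x ∂μ = 1) (hg₀_one : ∫ x, g₀ x ∂μ = 1)
    (hlim : ∀ x, Tendsto (fun n => g n x) atTop (𝓝 (g₀ x))) :
    Tendsto (fun n => ∫ x, |g n x - g₀ x| ∂μ) atTop (𝓝 0) := by
  have hnn : ∀ x, 0 ≤ g₀ x := fun x => ge_of_tendsto' (hlim x) fun n => hg_nonneg n x
  -- The difference has integral zero, so its positive and negative parts have equal mass; the part
  -- where `g₀` exceeds `g n` is dominated by `g₀`.
  have key : ∀ n, ∫ x, |g n x - g₀ x| ∂μ = 2 * ∫ x, max (g₀ x - g n x) 0 ∂μ := by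
    intro n
    have hm : Integrable (fun x => max (g₀ x - g n x) 0) μ := (hg₀.sub (hg n)).pos_part
    have h0 : ∫ x, (g n x - g₀ x) ∂μ = 0 := by
      rw [integral_sub (hg n) hg₀, hg_one, hg₀_one, sub_self]
    have h1 : ∀ x, |g n x - g₀ x| = (g n x - g₀ x) + 2 * max (g₀ x - g n x) 0 := by
      intro x
      rcases le_total (g n x) (g₀ x) with h | h
      · rw [abs_of_nonpos (by linarith), max_eq_left (by linarith)]; ring
      · rw [abs_of_nonneg (by linarith), max_eq_right (by linarith)]; ring
    simp_rw [h1]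
    have hs : Integrable (fun x => g n x - g₀ x) μ := (hg n).sub hg₀
    rw [integral_add hs (hm.const_mul 2), h0, zero_add, integral_const_mul]
  simp_rw [key]
  have hd : Tendsto (fun n => ∫ x, max (g₀ x - g n x) 0 ∂μ) atTop (𝓝 (∫ _, (0 : ℝ) ∂μ)) := by
    refine tendsto_integral_of_dominated_convergence g₀
      (fun n => ((hg₀.sub (hg n)).pos_part).aestronglyMeasurable) hg₀ (fun n => ae_of_all _ ?_)
      (ae_of_all _ ?_)
    · intro x
      rw [Real.norm_eq_abs, abs_of_nonneg (le_max_right _ _)]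
      exact max_le (by linarith [hg_nonneg n x]) (hnn x)
    · intro x
      have := ((hlim x).const_sub (g₀ x)).max (tendsto_const_nhds (x := (0 : ℝ)))
      simpa using this
  simpa using hd.const_mul 2

/-- A product of probability measures with densities has the product density. -/
theorem pi_withDensity_ofReal {ι : Type*} [Fintype ι] {f : ι → ℝ → ℝ}
    (hn : ∀ i z, 0 ≤ f i z) (hf : ∀ i, Integrable (f i)) :
    Measure.pi (fun i => volume.withDensity fun z => ENNReal.ofReal (f i z))
      = (volume : Measure (ι → ℝ)).withDensity fun z => ENNReal.ofReal (∏ i, f i (z i)) := by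
  have : ∀ i, IsFiniteMeasure (volume.withDensity fun z => ENNReal.ofReal (f i z)) := fun i =>
    isFiniteMeasure_withDensity_ofReal (hf i).2
  refine Measure.pi_eq (μ := fun i => volume.withDensity fun z => ENNReal.ofReal (f i z))
    fun s hs => ?_
  have hind : ∀ z : ι → ℝ, (Set.univ.pi s).indicator (fun z => ∏ i, f i (z i)) z
      = ∏ i, (s i).indicator (f i) (z i) := by
    classical
    intro z
    by_cases hz : z ∈ Set.univ.pi s
    · rw [Set.indicator_of_mem hz]
      exact Finset.prod_congr rfl fun i _ => (Set.indicator_of_mem (hz i trivial) _).symm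
    · rw [Set.indicator_of_notMem hz]
      obtain ⟨i, hi⟩ : ∃ i, z i ∉ s i := by simpa [Set.mem_pi] using hz
      exact (Finset.prod_eq_zero (Finset.mem_univ i) (Set.indicator_of_notMem hi _)).symm
  have hint : Integrable fun z : ι → ℝ => ∏ i, f i (z i) := Integrable.fintype_prod hf
  have hs' : MeasurableSet (Set.univ.pi s) := MeasurableSet.univ_pi hs
  rw [withDensity_apply _ hs', ← ofReal_integral_eq_lintegral_ofReal hint.integrableOn
    (ae_of_all _ fun z => Finset.prod_nonneg fun i _ => hn i _), ← integral_indicator hs']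
  simp_rw [hind]
  rw [integral_fintype_prod_volume_eq_prod (fun i => (s i).indicator (f i)),
    ENNReal.ofReal_prod_of_nonneg]
  · refine Finset.prod_congr rfl fun i _ => ?_
    rw [withDensity_apply _ (hs i), ← ofReal_integral_eq_lintegral_ofReal (hf i).integrableOn
      (ae_of_all _ (hn i)), integral_indicator (hs i)]
  · exact fun i _ => integral_nonneg fun z => Set.indicator_nonneg (fun z _ => hn i z) z

/-- Densities converging uniformly to a continuous density are asymptotically invariant under
small diagonal translations of their product. -/
theorem tendsto_integral_abs_prod_shift_sub {ι : Type*} [Fintype ι] {f : ℕ → ι → ℝ → ℝ}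
    {φ : ℝ → ℝ} (hφ : Continuous φ) (hφi : Integrable φ) (hφ1 : ∫ z, φ z = 1)
    (hn : ∀ n i z, 0 ≤ f n i z) (hf : ∀ n i, Integrable (f n i)) (hf1 : ∀ n i, ∫ z, f n i z = 1)
    {ε : ℕ → ℝ} (hε : Tendsto ε atTop (𝓝 0))
    (hfφ : ∀ i, ∀ᶠ n in atTop, ∀ z, |f n i z - φ z| ≤ ε n)
    {t : ℕ → ℝ} (ht : Tendsto t atTop (𝓝 0)) :
    Tendsto (fun n => ∫ z : ι → ℝ, |∏ i, f n i (z i - t n) - ∏ i, f n i (z i)|) atTop (𝓝 0) := by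
  -- Since the bound on `f n i - φ` is uniform in z, it may be used at the moving point `z - t n`;
  -- continuity of `φ` does the rest.
  have hpt : ∀ t : ℕ → ℝ, Tendsto t atTop (𝓝 0) → ∀ (i : ι) (z : ℝ),
      Tendsto (fun n => f n i (z - t n)) atTop (𝓝 (φ z)) := by
    intro t ht i z
    have h1 : Tendsto (fun n => φ (z - t n)) atTop (𝓝 (φ z)) := by
      have := (hφ.tendsto (z - 0)).comp (ht.const_sub z)
      simpa [Function.comp_def] using this
    have h2 : Tendsto (fun n => f n i (z - t n) - φ (z - t n)) atTop (𝓝 0) := by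
      refine squeeze_zero_norm' ?_ hε
      filter_upwards [hfφ i] with n h using h _
    simpa using h2.add h1
  have hφp : Integrable fun z : ι → ℝ => ∏ i, φ (z i) :=
    Integrable.fintype_prod (f := fun _ => φ) fun _ => hφi
  have hφp1 : ∫ z : ι → ℝ, ∏ i, φ (z i) = 1 := by
    rw [integral_fintype_prod_volume_eq_prod (fun _ => φ)]; simp [hφ1]
  have hint : ∀ (c : ℝ) n, Integrable fun z : ι → ℝ => ∏ i, f n i (z i - c) := fun c n =>
    Integrable.fintype_prod (f := fun i z => f n i (z - c)) fun i => (hf n i).comp_sub_right c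
  have key : ∀ t : ℕ → ℝ, Tendsto t atTop (𝓝 0) →
      Tendsto (fun n => ∫ z : ι → ℝ, |∏ i, f n i (z i - t n) - ∏ i, φ (z i)|) atTop (𝓝 0) := by
    intro t ht
    refine tendsto_integral_abs_sub_of_tendsto_density (fun n => hint _ n) hφp
      (fun n z => Finset.prod_nonneg fun i _ => hn n i _) (fun n => ?_) hφp1
      (fun z => tendsto_finsetProd _ fun i _ => hpt t ht i (z i))
    rw [integral_fintype_prod_volume_eq_prod (fun i z => f n i (z - t n))]
    refine Finset.prod_eq_one fun i _ => ?_
    rw [integral_sub_right_eq_self (f n i), hf1]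
  -- The shifted and unshifted products have the same L¹ limit, so the triangle inequality through
  -- it suffices.
  have hsum := (key t ht).add (key (fun _ => 0) tendsto_const_nhds)
  rw [add_zero] at hsum
  refine squeeze_zero (fun n => integral_nonneg fun z => abs_nonneg _) (fun n => ?_) hsum
  have i1 := ((hint (t n) n).sub hφp).abs
  have i2 := ((hint 0 n).sub hφp).abs
  have i3 : Integrable fun z : ι → ℝ => ∏ i, f n i (z i) := by simpa using hint 0 n
  refine (integral_mono ((hint (t n) n).sub i3).abs (i1.add i2) fun z => ?_).trans_eq
    (integral_add i1 i2)
  have := abs_sub_le (∏ i, f n i (z i - t n)) (∏ i, φ (z i)) (∏ i, f n i (z i))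
  simp only [Pi.add_apply, Pi.sub_apply, sub_zero]
  rwa [abs_sub_comm (∏ i, φ (z i))] at this

/-- The change of the probability of an event under a translation in the second coordinate is
controlled by the translation modulus of the density. -/
theorem abs_measureReal_shift_sub_le {X ι : Type*} [MeasurableSpace X] [Fintype ι]
    (ν : Measure X) [IsProbabilityMeasure ν] {F : (ι → ℝ) → ℝ} (hFm : Measurable F)
    (hF0 : ∀ z, 0 ≤ F z) (hF : Integrable F) {A : Set (X × (ι → ℝ))} (hA : MeasurableSet A)
    (v : ι → ℝ) :
    |(ν.prod (volume.withDensity fun z => ENNReal.ofReal (F z))).real {p | (p.1, p.2 + v) ∈ A}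
      - (ν.prod (volume.withDensity fun z => ENNReal.ofReal (F z))).real A|
      ≤ ∫ z, |F (z - v) - F z| := by
  have : IsFiniteMeasure (volume.withDensity fun z => ENNReal.ofReal (F z)) :=
    isFiniteMeasure_withDensity_ofReal hF.2
  set H : (ι → ℝ) → ℝ := fun z => ν.real {x | (x, z) ∈ A} with hH
  have hHm : Measurable H := (measurable_measure_prodMk_right hA).ennreal_toReal
  have hHb : ∀ z, ‖H z‖ ≤ 1 := fun z => by
    rw [Real.norm_eq_abs, abs_of_nonneg measureReal_nonneg]; exact measureReal_le_one
  have hreal : ∀ S : Set (X × (ι → ℝ)), MeasurableSet S →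
      (ν.prod (volume.withDensity fun z => ENNReal.ofReal (F z))).real S
        = ∫ z, F z * ν.real {x | (x, z) ∈ S} := by
    intro S hS
    rw [measureReal_def, Measure.prod_apply_symm hS,
      ← integral_toReal (measurable_measure_prodMk_right hS).aemeasurable
        (ae_of_all _ fun z => measure_lt_top _ _),
      integral_withDensity_eq_integral_toReal_smul hFm.ennreal_ofReal
        (ae_of_all _ fun _ => ENNReal.ofReal_lt_top)]
    refine integral_congr_ae (ae_of_all _ fun z => ?_)
    simp only [ENNReal.toReal_ofReal (hF0 z), smul_eq_mul]
    rfl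
  have hA' : MeasurableSet {p : X × (ι → ℝ) | (p.1, p.2 + v) ∈ A} :=
    (show Measurable fun p : X × (ι → ℝ) => (p.1, p.2 + v) by fun_prop) hA
  have hFv : Integrable fun z => F (z - v) := hF.comp_sub_right v
  rw [hreal _ hA', hreal A hA]
  -- Invariance of Lebesgue measure moves the shift from the event to the density; the section
  -- probabilities `H` are bounded by 1.
  have hsh : ∫ z, F z * ν.real {x | (x, z) ∈ {p : X × (ι → ℝ) | (p.1, p.2 + v) ∈ A}}
      = ∫ z, F (z - v) * H z := by
    rw [← integral_add_right_eq_self (fun z => F (z - v) * H z) v]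
    simp [hH]
  have i1 : Integrable fun z => F (z - v) * H z :=
    hFv.mul_bdd hHm.aestronglyMeasurable (ae_of_all _ hHb)
  have i2 : Integrable fun z => F z * H z :=
    hF.mul_bdd hHm.aestronglyMeasurable (ae_of_all _ hHb)
  rw [hsh, ← integral_sub i1 i2]
  refine abs_integral_le_integral_abs.trans
    (integral_mono (i1.sub i2).abs (hFv.sub hF).abs fun z => ?_)
  simp only [← sub_mul, abs_mul]
  exact mul_le_of_le_one_right (abs_nonneg _) (hHb z)

/-! ### Equidistribution modulo one by averaging over a period -/

/-- By periodicity the window starting at `x` can be replaced by [0, 1]. The endpoints are discarded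
as null because `Int.fract` drops to 0 at 1. -/
theorem integral_indicator_fract_add (x : ℝ) {a : ℝ} (ha : a ∈ Set.Icc (0 : ℝ) 1) :
    ∫ u in (0 : ℝ)..1, {y : ℝ | Int.fract y ≤ a}.indicator (1 : ℝ → ℝ) (x + u) = a := by
  set g : ℝ → ℝ := {y : ℝ | Int.fract y ≤ a}.indicator 1 with hg
  have hper : Function.Periodic g 1 := fun y => by
    simp [hg, Set.indicator_apply]
  have h1 : ∫ u in (0 : ℝ)..1, g (x + u) = ∫ u in (0 : ℝ)..(0 + 1), g u := by
    rw [intervalIntegral.integral_comp_add_left, add_zero, hper.intervalIntegral_add_eq x 0]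
  have h2 : Set.EqOn g ((Set.Iic a).indicator 1) (Set.Ioo 0 1) := fun u hu => by
    simp [hg, Set.indicator_apply, Int.fract_eq_self.2 ⟨hu.1.le, hu.2⟩]
  rw [h1, zero_add, intervalIntegral.integral_of_le zero_le_one,
    integral_Ioc_eq_integral_Ioo, setIntegral_congr_fun measurableSet_Ioo h2,
    ← integral_Ioc_eq_integral_Ioo, setIntegral_indicator measurableSet_Iic]
  simp [Set.Ioc_inter_Iic, min_eq_right ha.2, ha.1]

theorem measurableSet_fract_le {α : Type*} [MeasurableSpace α] {Φ : α → ℝ} (hΦ : Measurable Φ)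
    (a : ℝ) : MeasurableSet {p | Int.fract (Φ p) ≤ a} :=
  measurableSet_le hΦ.fract measurable_const

/-- Averaging over a full period makes every fractional part uniform. -/
theorem integral_measureReal_fract_add_le {α : Type*} [MeasurableSpace α] (ρ : Measure α)
    [IsProbabilityMeasure ρ] {Φ : α → ℝ} (hΦ : Measurable Φ) {a : ℝ} (ha : a ∈ Set.Icc (0 : ℝ) 1) :
    ∫ u in (0 : ℝ)..1, ρ.real {p | Int.fract (Φ p + u) ≤ a} = a := by
  have hS : MeasurableSet {q : ℝ × α | Int.fract (Φ q.2 + q.1) ≤ a} :=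
    measurableSet_fract_le ((hΦ.comp measurable_snd).add measurable_fst) a
  have : IsFiniteMeasure (volume.restrict (Set.uIoc (0 : ℝ) 1)) :=
    ⟨by rw [Measure.restrict_apply_univ]; simp [Set.uIoc]⟩
  have hi : Integrable (Function.uncurry fun (u : ℝ) (p : α) =>
      {y : ℝ | Int.fract y ≤ a}.indicator (1 : ℝ → ℝ) (Φ p + u))
      ((volume.restrict (Set.uIoc 0 1)).prod ρ) := by
    have : (Function.uncurry fun (u : ℝ) (p : α) =>
        {y : ℝ | Int.fract y ≤ a}.indicator (1 : ℝ → ℝ) (Φ p + u))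
        = {q : ℝ × α | Int.fract (Φ q.2 + q.1) ≤ a}.indicator 1 := by
      ext q; simp [Function.uncurry, Set.indicator_apply]
    rw [this]
    exact (integrable_const (1 : ℝ)).indicator hS
  have hr : ∀ u : ℝ, ρ.real {p | Int.fract (Φ p + u) ≤ a}
      = ∫ p, {y : ℝ | Int.fract y ≤ a}.indicator (1 : ℝ → ℝ) (Φ p + u) ∂ρ := by
    intro u
    rw [← integral_indicator_one (measurableSet_fract_le (hΦ.add_const u) a)]
    rfl
  simp_rw [hr]
  rw [intervalIntegral_integral_swap hi]
  simp [integral_indicator_fract_add _ ha]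

/-- If densities are asymptotically invariant under small diagonal translations, then a real
statistic which moves at unboundedly growing speed along the diagonal equidistributes modulo one. -/
theorem tendsto_measureReal_fract_le {X ι : Type*} [MeasurableSpace X] [Fintype ι]
    (ν : Measure X) [IsProbabilityMeasure ν] {F : ℕ → (ι → ℝ) → ℝ} (hFm : ∀ n, Measurable (F n))
    (hF0 : ∀ n z, 0 ≤ F n z) (hF : ∀ n, Integrable (F n)) (hF1 : ∀ n, ∫ z, F n z = 1)
    (hshift : ∀ t : ℕ → ℝ, Tendsto t atTop (𝓝 0) →
      Tendsto (fun n => ∫ z, |F n (z - fun _ => t n) - F n z|) atTop (𝓝 0))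
    {Φ : ℕ → X × (ι → ℝ) → ℝ} (hΦ : ∀ n, Measurable (Φ n)) {r : ℕ → ℝ}
    (hr : Tendsto r atTop (𝓝 0))
    (hΦr : ∀ᶠ n in atTop, ∀ p u, Φ n (p.1, p.2 + fun _ => u * r n) = Φ n p + u)
    {a : ℝ} (ha : a ∈ Set.Icc (0 : ℝ) 1) :
    Tendsto (fun n => (ν.prod (volume.withDensity fun z => ENNReal.ofReal (F n z))).real
      {p | Int.fract (Φ n p) ≤ a}) atTop (𝓝 a) := by
  set ρ : ℕ → Measure (X × (ι → ℝ)) := fun n =>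
    ν.prod (volume.withDensity fun z => ENNReal.ofReal (F n z)) with hρ
  have : ∀ n, IsProbabilityMeasure (volume.withDensity fun z => ENNReal.ofReal (F n z)) :=
    fun n => ⟨by
      rw [withDensity_apply _ MeasurableSet.univ, Measure.restrict_univ,
        ← ofReal_integral_eq_lintegral_ofReal (hF n) (ae_of_all _ (hF0 n)), hF1,
        ENNReal.ofReal_one]⟩
  have : ∀ n, IsProbabilityMeasure (ρ n) := fun n => by simp only [hρ]; infer_instance
  set G : ℕ → ℝ → ℝ := fun n u => (ρ n).real {p | Int.fract (Φ n p + u) ≤ a} with hG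
  have hGm : ∀ n, Measurable (G n) := fun n =>
    (measurable_measure_prodMk_left (measurableSet_fract_le (α := ℝ × (X × (ι → ℝ)))
      (((hΦ n).comp measurable_snd).add measurable_fst) a)).ennreal_toReal
  have hGb : ∀ n u, ‖G n u‖ ≤ 1 := fun n u => by
    rw [Real.norm_eq_abs, abs_of_nonneg measureReal_nonneg]; exact measureReal_le_one
  have hGi : ∀ n, IntervalIntegrable (G n) volume 0 1 := fun n =>
    (intervalIntegrable_const (c := (1 : ℝ))).mono_fun (hGm n).aestronglyMeasurable
      (ae_of_all _ fun u => by simpa using hGb n u)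
  -- Adding `u` to the statistic amounts to translating `z` by `u * r n`, which tends to 0 for each
  -- fixed `u`.
  have hpt : ∀ u, Tendsto (fun n => G n u - G n 0) atTop (𝓝 0) := by
    intro u
    have ht : Tendsto (fun n => u * r n) atTop (𝓝 0) := by simpa using hr.const_mul u
    refine squeeze_zero_norm' ?_ (hshift _ ht)
    filter_upwards [hΦr] with n hn
    have := abs_measureReal_shift_sub_le ν (hFm n) (hF0 n) (hF n)
      (measurableSet_fract_le (hΦ n) a) (fun _ => u * r n)
    simpa only [hG, Set.mem_ofPred_eq, hn, add_zero, Real.norm_eq_abs] using this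
  have hdom : Tendsto (fun n => ∫ u in (0 : ℝ)..1, (G n u - G n 0)) atTop
      (𝓝 (∫ _ in (0 : ℝ)..1, (0 : ℝ))) := by
    refine intervalIntegral.tendsto_integral_filter_of_dominated_convergence (fun _ => 2)
      (Eventually.of_forall fun n => ((hGm n).sub_const _).aestronglyMeasurable)
      (Eventually.of_forall fun n => ae_of_all _ fun u _ => ?_) intervalIntegrable_const
      (ae_of_all _ fun u _ => hpt u)
    exact (norm_sub_le _ _).trans (by linarith [hGb n u, hGb n 0])
  -- The average of `G n` over a period is `a` for every `n`, with no limit taken, so the vanishing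
  -- integral forces `G n 0` to tend to `a`.
  have heq : ∀ n, ∫ u in (0 : ℝ)..1, (G n u - G n 0) = a - G n 0 := by
    intro n
    rw [intervalIntegral.integral_sub (hGi n) intervalIntegrable_const,
      integral_measureReal_fract_add_le (ρ n) (hΦ n) ha]
    simp
  simp only [heq, intervalIntegral.integral_zero] at hdom
  have := hdom.const_sub a
  simpa [hG] using this

/-! ### Independence, densities and significands -/

/-- Jointly independent variables indexed by pairs form independent families. -/
theorem iIndepFun_curry {Ω ι : Type*} {κ : ι → Type*} [MeasurableSpace Ω] {P : Measure Ω}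
    {𝓧 : (i : ι) → κ i → Type*} [∀ i j, MeasurableSpace (𝓧 i j)]
    {X : (i : ι) → (j : κ i) → Ω → 𝓧 i j} (mX : ∀ i j, Measurable (X i j))
    (h : iIndepFun (fun (p : (i : ι) × κ i) ω => X p.1 p.2 ω) P) :
    iIndepFun (fun i ω j => X i j ω) P := by
  have := h.isProbabilityMeasure
  have : ∀ i j, IsProbabilityMeasure (P.map (X i j)) :=
    fun i j => Measure.isProbabilityMeasure_map (mX i j).aemeasurable
  -- Independence is read as the joint law being a product measure; currying carries the product
  -- over pairs to the iterated product.
  have hc : (MeasurableEquiv.piCurry 𝓧) ∘ (fun ω p => X p.1 p.2 ω) = fun ω i j => X i j ω := by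
    ext; simp [Sigma.curry]
  have hrow : ∀ i, P.map (fun ω j => X i j ω) = Measure.infinitePi fun j => P.map (X i j) :=
    fun i => iIndepFun.map_fun_eq_infinitePi_map (mX i)
      (h.precomp (g := fun j => (⟨i, j⟩ : (i : ι) × κ i)) sigma_mk_injective)
  rw [iIndepFun_iff_map_fun_eq_infinitePi_map fun i => by fun_prop]
  simp_rw [hrow]
  rw [← Measure.infinitePi_map_piCurry (fun i j => P.map (X i j)), ← hc,
    ← Measure.map_map (by fun_prop) (by fun_prop),
    iIndepFun.map_fun_eq_infinitePi_map (by fun_prop) h]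

theorem integrable_and_integral_eq_one_of_withDensity {f : ℝ → ℝ} (hf : Measurable f)
    (hn : ∀ z, 0 ≤ f z)
    (hp : IsProbabilityMeasure (volume.withDensity fun z => ENNReal.ofReal (f z))) :
    Integrable f ∧ ∫ z, f z = 1 := by
  have h1 := hp.measure_univ
  rw [withDensity_apply _ MeasurableSet.univ, Measure.restrict_univ] at h1
  refine ⟨⟨hf.aestronglyMeasurable, ?_⟩, ?_⟩
  · rw [hasFiniteIntegral_iff_ofReal (ae_of_all _ hn), h1]; exact ENNReal.one_lt_top
  · rw [integral_eq_lintegral_of_nonneg_ae (ae_of_all _ hn) hf.aestronglyMeasurable, h1,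
      ENNReal.toReal_one]

theorem logb_significand {B x : ℝ} (hB : 1 < B) (hx : 0 < x) :
    Real.logb B (significand B x) = Int.fract (Real.logb B x) := by
  have hB0 : 0 < B := by linarith
  rw [significand, Real.logb_div hx.ne' (zpow_pos hB0 _).ne', ← Real.rpow_intCast,
    Real.logb_rpow hB0 hB.ne', Int.fract]

/-- Translates Benford behavior into uniformity of the base-`B` logarithm modulo one. -/
theorem significand_le_iff {B x s : ℝ} (hB : 1 < B) (hx : 0 < x) (hs : 0 < s) :
    significand B x ≤ s ↔ Int.fract (Real.logb B x) ≤ Real.logb B s := by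
  rw [← logb_significand hB hx, Real.logb_le_logb hB
    (by linarith [(significand_spec hB hx).1.1]) hs]

/-! ### Side lengths of the fragmentation process -/

section Boxes

variable {Ω : Type*} {m : ℕ} {𝔅 : ℕ → Ω → BoxIntegral.Box (Fin m)}

theorem sideLength_pos (b : BoxIntegral.Box (Fin m)) (i : Fin m) : 0 < sideLength b i :=
  sub_pos.2 (b.lower_lt_upper i)

theorem cut_pos (n : ℕ) (i : Fin m) (ω : Ω) : 0 < cut 𝔅 n i ω :=
  div_pos (sideLength_pos _ i) (sideLength_pos _ i)

theorem sideLength_eq_mul_prod_cut (n : ℕ) (i : Fin m) (ω : Ω) :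
    sideLength (𝔅 n ω) i = sideLength (𝔅 0 ω) i * ∏ k ∈ Finset.range n, cut 𝔅 k i ω := by
  induction n with
  | zero => simp
  | succ n ih =>
    rw [Finset.prod_range_succ, ← mul_assoc, ← ih, cut,
      mul_div_cancel₀ _ (sideLength_pos _ i).ne']

/-- The slope √n σ is the same on all axes, so a diagonal translation of the `Z` vector rescales all
sides by one factor. For `n = 0` the normalization divides by zero. -/
theorem sideLength_eq_rpow {B μP σP : ℝ} (hB : 1 < B) (hσ : 0 < σP) {n : ℕ} (hn : 0 < n)
    (i : Fin m) (ω : Ω) :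
    sideLength (𝔅 n ω) i = B ^ (Real.logb B (sideLength (𝔅 0 ω) i) +
      (n * μP + Real.sqrt n * σP * Z B 𝔅 μP σP i n ω)) := by
  have hB0 : 0 < B := by linarith
  have hne : Real.sqrt n * σP ≠ 0 := (mul_pos (Real.sqrt_pos.2 (by exact_mod_cast hn)) hσ).ne'
  have hpr : 0 < ∏ k ∈ Finset.range n, cut 𝔅 k i ω := Finset.prod_pos fun k _ => cut_pos k i ω
  rw [Z, mul_div_cancel₀ _ hne, add_sub_cancel, Real.rpow_add hB0,
    Real.rpow_logb hB0 hB.ne' (sideLength_pos _ i), Real.rpow_logb hB0 hB.ne' hpr,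
    ← sideLength_eq_mul_prod_cut]

variable [MeasurableSpace Ω] {Pr : Measure Ω} {B μP σP : ℝ}

theorem IsLinearFragmentation.measurable_sideLength (h𝔅 : IsLinearFragmentation Pr B 𝔅 μP σP)
    (n : ℕ) (i : Fin m) : Measurable fun ω => sideLength (𝔅 n ω) i :=
  ((measurable_pi_apply i).comp (h𝔅.measurable_upper n)).sub
    ((measurable_pi_apply i).comp (h𝔅.measurable_lower n))

theorem IsLinearFragmentation.measurable_cut (h𝔅 : IsLinearFragmentation Pr B 𝔅 μP σP)
    (n : ℕ) (i : Fin m) : Measurable (cut 𝔅 n i) :=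
  (h𝔅.measurable_sideLength (n + 1) i).div (h𝔅.measurable_sideLength n i)

theorem measurable_logb (B : ℝ) : Measurable (Real.logb B) :=
  Real.measurable_log.div_const _

theorem measurable_normalize (B μP σP : ℝ) (n : ℕ) : Measurable fun x : ℕ → ℝ =>
    (Real.logb B (∏ k ∈ Finset.range n, x k) - n * μP) / (Real.sqrt n * σP) :=
  (((measurable_logb B).comp
    (Finset.measurable_fun_prod _ fun k _ => measurable_pi_apply k)).sub_const _).div_const _

theorem IsLinearFragmentation.measurable_Z (h𝔅 : IsLinearFragmentation Pr B 𝔅 μP σP)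
    (n : ℕ) (i : Fin m) : Measurable (Z B 𝔅 μP σP i n) :=
  (measurable_normalize B μP σP n).comp
    (measurable_pi_lambda (fun ω k => cut 𝔅 k i ω) fun k => h𝔅.measurable_cut k i)

/-- The normalised sums along the axes are independent of each other and of the initial box. -/
theorem IsLinearFragmentation.map_initial_Z [IsProbabilityMeasure Pr]
    (h𝔅 : IsLinearFragmentation Pr B 𝔅 μP σP) (n : ℕ) :
    Pr.map (fun ω => (fun i => Real.logb B (sideLength (𝔅 0 ω) i), fun i => Z B 𝔅 μP σP i n ω))
      = (Pr.map fun ω i => Real.logb B (sideLength (𝔅 0 ω) i)).prod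
        (Measure.pi fun i => Pr.map (Z B 𝔅 μP σP i n)) := by
  -- The cuts are regrouped axis by axis; each `Z` is a function of the cuts on its own axis.
  have hZ : iIndepFun (fun i => Z B 𝔅 μP σP i n) Pr :=
    (iIndepFun_curry (X := fun (i : Fin m) (k : ℕ) => cut 𝔅 k i)
      (fun i k => h𝔅.measurable_cut k i)
      (h𝔅.indep_cuts.precomp (g := fun p : (_ : Fin m) × ℕ => (p.2, p.1))
        (fun p q h => by
          obtain ⟨h1, h2⟩ := Prod.mk.inj h
          exact Sigma.ext h2 (heq_of_eq h1)))).comp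
      (fun _ x => (Real.logb B (∏ k ∈ Finset.range n, x k) - n * μP) / (Real.sqrt n * σP))
      (fun _ => measurable_normalize B μP σP n)
  have hind : IndepFun (fun ω i => Real.logb B (sideLength (𝔅 0 ω) i))
      (fun ω i => Z B 𝔅 μP σP i n ω) Pr :=
    h𝔅.indep_initial.comp
      (φ := fun p : (Fin m → ℝ) × (Fin m → ℝ) => fun i => Real.logb B (p.2 i - p.1 i))
      (ψ := fun (x : ℕ × Fin m → ℝ) (i : Fin m) =>
        (Real.logb B (∏ k ∈ Finset.range n, x (k, i)) - n * μP) / (Real.sqrt n * σP))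
      (measurable_pi_lambda _ fun i => (measurable_logb B).comp (by fun_prop))
      (measurable_pi_lambda _ fun i => (measurable_normalize B μP σP n).comp
        (measurable_pi_lambda (fun (x : ℕ × Fin m → ℝ) k => x (k, i)) fun k =>
          measurable_pi_apply _))
  rw [← iIndepFun.map_fun_eq_pi_map (fun i => (h𝔅.measurable_Z n i).aemeasurable) hZ]
  exact hind.map_prod_eq_prod_map_map
    (measurable_pi_lambda _ fun i =>
      (measurable_logb B).comp (h𝔅.measurable_sideLength 0 i)).aemeasurable
    (measurable_pi_lambda _ fun i => h𝔅.measurable_Z n i).aemeasurable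

/-- Under a local limit theorem for the normalised sums, every positive homogeneous function of
the side lengths converges to strong Benford behavior. -/
theorem IsLinearFragmentation.convergesToStrongBenford_of_homogeneous [IsProbabilityMeasure Pr]
    (hB : 1 < B) (h𝔅 : IsLinearFragmentation Pr B 𝔅 μP σP)
    {ε : ℕ → ℝ} (hε : Tendsto ε atTop (𝓝 0))
    (hpdf : ∀ i, ∀ᶠ n : ℕ in atTop, ∃ f : ℝ → ℝ, Measurable f ∧ (∀ z, 0 ≤ f z) ∧
      Pr.map (Z B 𝔅 μP σP i n) = volume.withDensity (fun z => ENNReal.ofReal (f z)) ∧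
      ∀ z, |f z - gaussianPDFReal 0 1 z| ≤ ε n)
    {V : (Fin m → ℝ) → ℝ} (hVm : Measurable V) (hVpos : ∀ y, (∀ i, 0 < y i) → 0 < V y)
    {d : ℕ} (hd : 1 ≤ d) (hV : ∀ c y, 0 < c → V (fun i => c * y i) = c ^ d * V y) :
    ConvergesToStrongBenford Pr B fun n ω => V (sideLength (𝔅 n ω)) := by
  classical
  have hB0 : 0 < B := by linarith
  have hσ := h𝔅.sd_pos
  -- Densities are given only for large `n`. The Gaussian density serves as default elsewhere, so
  -- that `f n i` is a probability density for all `n`.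
  have hex : ∀ (n : ℕ) (i : Fin m), ∃ f : ℝ → ℝ, (Measurable f ∧ (∀ z, 0 ≤ f z) ∧
      Integrable f ∧ ∫ z, f z = 1) ∧
      ((∃ f : ℝ → ℝ, Measurable f ∧ (∀ z, 0 ≤ f z) ∧
        Pr.map (Z B 𝔅 μP σP i n) = volume.withDensity (fun z => ENNReal.ofReal (f z)) ∧
        ∀ z, |f z - gaussianPDFReal 0 1 z| ≤ ε n) →
        Pr.map (Z B 𝔅 μP σP i n) = volume.withDensity (fun z => ENNReal.ofReal (f z)) ∧
        ∀ z, |f z - gaussianPDFReal 0 1 z| ≤ ε n) := by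
    intro n i
    by_cases h : ∃ f : ℝ → ℝ, Measurable f ∧ (∀ z, 0 ≤ f z) ∧
        Pr.map (Z B 𝔅 μP σP i n) = volume.withDensity (fun z => ENNReal.ofReal (f z)) ∧
        ∀ z, |f z - gaussianPDFReal 0 1 z| ≤ ε n
    · obtain ⟨f, hfm, hf0, hlaw, hfε⟩ := h
      exact ⟨f, ⟨hfm, hf0, integrable_and_integral_eq_one_of_withDensity hfm hf0
        (hlaw ▸ Measure.isProbabilityMeasure_map (h𝔅.measurable_Z n i).aemeasurable)⟩,
        fun _ => ⟨hlaw, hfε⟩⟩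
    · exact ⟨gaussianPDFReal 0 1, ⟨measurable_gaussianPDFReal 0 1, gaussianPDFReal_nonneg 0 1,
        integrable_gaussianPDFReal 0 1, integral_gaussianPDFReal_eq_one 0 one_ne_zero⟩,
        fun h' => absurd h' h⟩
  choose f hf hfl using hex
  have hφ : Continuous (gaussianPDFReal 0 1) := by
    rw [gaussianPDFReal_def]; fun_prop
  set F : ℕ → (Fin m → ℝ) → ℝ := fun n z => ∏ i, f n i (z i) with hF
  set ν : Measure (Fin m → ℝ) := Pr.map fun ω i => Real.logb B (sideLength (𝔅 0 ω) i) with hν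
  have hLm : Measurable fun ω i => Real.logb B (sideLength (𝔅 0 ω) i) :=
    measurable_pi_lambda _ fun i => (measurable_logb B).comp (h𝔅.measurable_sideLength 0 i)
  have : IsProbabilityMeasure ν := Measure.isProbabilityMeasure_map hLm.aemeasurable
  have hlaw : ∀ᶠ n in atTop, Pr.map (fun ω => (fun i => Real.logb B (sideLength (𝔅 0 ω) i),
      fun i => Z B 𝔅 μP σP i n ω))
      = ν.prod (volume.withDensity fun z => ENNReal.ofReal (F n z)) := by
    filter_upwards [eventually_all.2 hpdf] with n hn
    rw [h𝔅.map_initial_Z n, ← pi_withDensity_ofReal (fun i => (hf n i).2.1)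
      (fun i => (hf n i).2.2.1)]
    simp_rw [fun i => (hfl n i (hn i)).1]
    rfl
  set Y : ℕ → (Fin m → ℝ) × (Fin m → ℝ) → Fin m → ℝ := fun n p i =>
    B ^ (p.1 i + (n * μP + Real.sqrt n * σP * p.2 i)) with hY
  have hYm : ∀ n, Measurable (Y n) := fun n => by
    refine measurable_pi_lambda _ fun i => ?_
    exact Measurable.pow measurable_const (by fun_prop)
  have hYpos : ∀ n p i, 0 < Y n p i := fun n p i => Real.rpow_pos_of_pos hB0 _
  set Φ : ℕ → (Fin m → ℝ) × (Fin m → ℝ) → ℝ := fun n p => Real.logb B (V (Y n p)) with hΦ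
  have hΦm : ∀ n, Measurable (Φ n) := fun n => (measurable_logb B).comp (hVm.comp (hYm n))
  have hd0 : (0 : ℝ) < d := by exact_mod_cast hd
  -- Translation by `u * r n` adds u / d to each exponent, and degree `d` homogeneity turns this
  -- into the factor `B ^ u`.
  set r : ℕ → ℝ := fun n => 1 / (d * (Real.sqrt n * σP)) with hr
  have hr0 : Tendsto r atTop (𝓝 0) := by
    have h1 : Tendsto (fun n : ℕ => (d : ℝ) * (Real.sqrt n * σP)) atTop atTop :=
      ((Real.tendsto_sqrt_atTop.comp tendsto_natCast_atTop_atTop).atTop_mul_const hσ).const_mul_atTop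
        hd0
    simp only [hr, one_div]
    exact h1.inv_tendsto_atTop
  have hΦr : ∀ᶠ n in atTop, ∀ p u, Φ n (p.1, p.2 + fun _ => u * r n) = Φ n p + u := by
    filter_upwards [eventually_gt_atTop 0] with n hn p u
    have hsn : (0 : ℝ) < Real.sqrt n := Real.sqrt_pos.2 (by exact_mod_cast hn)
    have hYs : Y n (p.1, p.2 + fun _ => u * r n) = fun i => B ^ (u / d) * Y n p i := by
      funext i
      simp only [hY, hr, Pi.add_apply]
      rw [← Real.rpow_add hB0]
      congr 1
      field_simp
      ring
    have hpow : (B ^ (u / d)) ^ d = B ^ u := by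
      rw [← Real.rpow_natCast, ← Real.rpow_mul hB0.le, div_mul_cancel₀ _ hd0.ne']
    simp only [hΦ]
    rw [hYs, hV _ _ (Real.rpow_pos_of_pos hB0 _), hpow,
      Real.logb_mul (Real.rpow_pos_of_pos hB0 _).ne' (hVpos _ (hYpos n p)).ne',
      Real.logb_rpow hB0 hB.ne', add_comm]
  intro s hs
  have hs0 : 0 < s := by linarith [hs.1]
  have ha : Real.logb B s ∈ Set.Icc (0 : ℝ) 1 := ⟨Real.logb_nonneg hB hs.1, by
    rw [Real.logb_le_iff_le_rpow hB hs0, Real.rpow_one]; exact hs.2⟩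
  have hmain := tendsto_measureReal_fract_le ν (F := F)
    (fun n => Finset.measurable_fun_prod _ fun i _ => (hf n i).1.comp (measurable_pi_apply i))
    (fun n z => Finset.prod_nonneg fun i _ => (hf n i).2.1 _)
    (fun n => Integrable.fintype_prod fun i => (hf n i).2.2.1)
    (fun n => by
      simp only [hF]
      rw [integral_fintype_prod_volume_eq_prod (f n)]
      exact Finset.prod_eq_one fun i _ => (hf n i).2.2.2)
    (fun t ht => tendsto_integral_abs_prod_shift_sub hφ (integrable_gaussianPDFReal 0 1)
      (integral_gaussianPDFReal_eq_one 0 one_ne_zero) (fun n i => (hf n i).2.1)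
      (fun n i => (hf n i).2.2.1) (fun n i => (hf n i).2.2.2) hε
      (fun i => (hpdf i).mono fun n hn => (hfl n i hn).2) ht)
    hΦm hr0 hΦr ha
  refine hmain.congr' ?_
  filter_upwards [hlaw, eventually_gt_atTop 0] with n hn hn0
  rw [← hn, map_measureReal_apply (hLm.prodMk (measurable_pi_lambda _ fun i =>
    h𝔅.measurable_Z n i)) (measurableSet_fract_le (hΦm n) _)]
  congr 1
  ext ω
  have hside : sideLength (𝔅 n ω) = Y n (fun i => Real.logb B (sideLength (𝔅 0 ω) i),
      fun i => Z B 𝔅 μP σP i n ω) := funext fun i => sideLength_eq_rpow hB hσ hn0 i ω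
  simp only [Set.mem_preimage, Set.mem_ofPred_eq, hside, hΦ]
  rw [significand_le_iff hB (hVpos _ (hYpos n _)) hs0]

end Boxes

/-! ### The two homogeneous functionals -/

theorem prod_const_mul_of_card_eq {ι : Type*} {I : Finset ι} {d : ℕ} (hI : I.card = d) (c : ℝ)
    (y : ι → ℝ) : ∏ i ∈ I, c * y i = c ^ d * ∏ i ∈ I, y i := by
  rw [Finset.prod_mul_distrib, Finset.prod_const, hI]

end BoxFragmentation

theorem mainTheorem2 {Ω : Type*} [MeasurableSpace Ω] (Pr : Measure Ω) [IsProbabilityMeasure Pr]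
    (B : ℝ) (hB : 1 < B) (m : ℕ) (hm : 2 ≤ m) (𝔅 : ℕ → Ω → BoxIntegral.Box (Fin m)) (μP σP : ℝ)
    (h𝔅 : BoxFragmentation.IsLinearFragmentation Pr B 𝔅 μP σP)
    (C : ℝ) (hC : 0 < C)
    (hsupp : ∀ i, ∀ᵐ ω ∂Pr, Real.log (BoxFragmentation.cut 𝔅 0 i ω) ∈ Set.Icc (-C) C)
    (δ : ℝ) (hδ : 0 < δ) (K : ℝ)
    (hpdf : ∀ i, ∀ᶠ N : ℕ in atTop, ∃ f : ℝ → ℝ, Measurable f ∧ (∀ z, 0 ≤ f z) ∧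
      Pr.map (BoxFragmentation.Z B 𝔅 μP σP i N)
        = volume.withDensity (fun z => ENNReal.ofReal (f z)) ∧
      ∀ z, |f z - gaussianPDFReal 0 1 z| ≤ K * (N : ℝ) ^ (-(1 / 2 : ℝ) - δ))
    (hcdf : ∀ i, ∀ᶠ N : ℕ in atTop, ∀ z,
      |Pr.real {ω | BoxFragmentation.Z B 𝔅 μP σP i N ω ≤ z} - cdf (gaussianReal 0 1) z|
        ≤ K * (N : ℝ) ^ (-δ)) :
    ∀ d : ℕ, 1 ≤ d → d ≤ m →
      BoxFragmentation.ConvergesToStrongBenford Pr B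
        (fun N ω => BoxFragmentation.maxFaceVolume d (𝔅 N ω)) ∧
      BoxFragmentation.ConvergesToStrongBenford Pr B
        (fun N ω => BoxFragmentation.dVolume d (𝔅 N ω)) := by
  intro d hd hdm
  have hε : Tendsto (fun N : ℕ => K * (N : ℝ) ^ (-(1 / 2 : ℝ) - δ)) atTop (𝓝 0) := by
    have h := (tendsto_rpow_neg_atTop (y := 1 / 2 + δ) (by linarith)).comp
      (tendsto_natCast_atTop_atTop (R := ℝ))
    simpa only [Function.comp_def, neg_add', mul_zero] using h.const_mul K
  -- As `d ≤ m`, some `d`-subset exists; without one the supremum and the sum would be 0 rather than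
  -- positive.
  obtain ⟨I₀, -, hI₀⟩ := Finset.exists_subset_card_eq
    (s := (Finset.univ : Finset (Fin m))) (n := d) (by simpa using hdm)
  have hpos : ∀ y : Fin m → ℝ, (∀ i, 0 < y i) → ∀ I : Finset (Fin m), 0 < ∏ i ∈ I, y i :=
    fun y hy I => Finset.prod_pos fun i _ => hy i
  constructor
  · refine h𝔅.convergesToStrongBenford_of_homogeneous hB hε hpdf (d := d)
      (V := fun y => ⨆ I : {I : Finset (Fin m) // I.card = d}, ∏ i ∈ I.1, y i) ?_ ?_ hd ?_
    · exact Measurable.iSup fun I => Finset.measurable_fun_prod _ fun i _ => measurable_pi_apply i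
    · exact fun y hy => (hpos y hy I₀).trans_le
        (le_ciSup (f := fun I : {I : Finset (Fin m) // I.card = d} => ∏ i ∈ I.1, y i)
          (Set.finite_range _).bddAbove ⟨I₀, hI₀⟩)
    · intro c y hc
      simp only [Real.mul_iSup_of_nonneg (pow_nonneg hc.le d),
        fun I : {I : Finset (Fin m) // I.card = d} =>
          BoxFragmentation.prod_const_mul_of_card_eq I.2 c y]
  · refine h𝔅.convergesToStrongBenford_of_homogeneous hB hε hpdf (d := d)
      (V := fun y => 2 ^ (m - d) *
        ∑ I ∈ (Finset.univ : Finset (Fin m)).powersetCard d, ∏ i ∈ I, y i) ?_ ?_ hd ?_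
    · exact (Finset.measurable_fun_sum _ fun I _ =>
        Finset.measurable_fun_prod _ fun i _ => measurable_pi_apply i).const_mul _
    · exact fun y hy => mul_pos (by positivity) (Finset.sum_pos (fun I _ => hpos y hy I)
        ⟨I₀, Finset.mem_powersetCard.2 ⟨Finset.subset_univ _, hI₀⟩⟩)
    · intro c y _
      rw [mul_left_comm (c ^ d), Finset.mul_sum _ _ (c ^ d)]
      congr 1
      exact Finset.sum_congr rfl fun I hI =>
        BoxFragmentation.prod_const_mul_of_card_eq (Finset.mem_powersetCard.1 hI).2 c y
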